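/- **Setting.** An interaction graph $\mathrm G$ consists of a finite node set $\mathrm V=\{1,\dots,n\}$, a set $\mathrm E$ of arcs (self-arcs allowed) and real weights $a_{ij}$ with $a_{ij}\neq0$ iff $(j,i)\in\mathrm E$. Let $\mathrm N_i=\{j:(j,i)\in \mathrm E\}$, $A_{\mathrm G}=(a_{ij})$ and $\|A_{\mathrm G}\|_\infty=\max_i\sum_{j\in \mathrm N_i}|a_{ij}|$. The network dynamics are $$x_i(t+1)=\sum_{j\in \mathrm N_i}a_{ij}f(x_j(t))+u_i(t)+w_i(t),\qquad i\in\mathrm V,\ t=0,1,2,\dots,$$ with unknown $f:\mathbb R\to\mathbb R$, unknown disturbances with $|w_i(t)|\le w_*$, and estimates $z_i(t)$, available from time $t+1$ on, with $|f(x_i(t))-z_i(t)|\le D_0$; the constants $w_*>0$ and $D_0$ are unknown. A global-knowledge/global-decision feedback law on $n$ nodes is any family of functions $$U(t)=h_t\big(X(0),\dots,X(t);Z(0),\dots,Z(t-1);U(0),\dots,U(t-1);A_{\mathrm G}\big)\in\mathbb R^n .$$ A generic law is a choice of such a law for every number of nodes $n$. A law stabilizes $\mathrm G$ for $f$ if $\sup_t(|x_i(t)|+|u_i(t)|)<\infty$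 for all $i$, for every initial state, all $w_*,D_0$, and all admissible disturbances and estimates. For $L>0$ let $\mathcal F_L$ be the set of all $f$ with $$\lim_{\alpha\to\infty}\sup_{x,y}\frac{|f(x)-f(y)|}{|x-y|+\alpha}\le L .$$ For $f\in\mathcal F_L$ and $r>L$ let $\mathfrak W_f(r)$ be the infimum of all $c\ge0$ for which there is $\eta>0$ with $L+\eta<r$ and $|f(x)-f(y)|\le(L+\eta)|x-y|+c$ for all $x,y$. The nearest-neighbour law with parameter $\epsilon>0$ has $U(0)=0$. For $t\ge1$ let $x_{v_i}(s_i)$ be a state nearest to $x_i(t)$ among all $x_j(\tau)$ with $j\in \mathrm V$, $0\le\tau\le t-1$ (ties broken arbitrarily). Then $u_i(t)=-\sum_{j\in\mathrm N_i}a_{ij}z_{v_j}(s_j)$ if $|x_k(t)-x_{v_k}(s_k)|\le\epsilon$ for all $k$. Otherwise $\tfrac12\big(\min_{s\le t,k}x_k(s)+\max_{s\le t,k}x_k(s)\big)$ is added to this expression. **Theorem.** Let $L>0$. For every $a>0$, there is a generic global-knowledge/global-decision feedback law that stabilizes all graphs $\mathrm G$ with $\|A_{\mathrm G}\|_\infty=a$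 for all $f\in\mathcal F_L$ if and only if $L<(3/2+\sqrt2)/a$. More precisely: (i) For every $n$ and $\epsilon>0$ nearest-neighbour laws exist. Every such law stabilizes every graph $\mathrm G$ on $n$ nodes with $L<(3/2+\sqrt2)/\|A_{\mathrm G}\|_\infty$ (read as $+\infty$ if $A_{\mathrm G}=0$) for all $f\in\mathcal F_L$, and ensures for all $i\in\mathrm V$ $$\limsup_{t\to\infty}|x_i(t)|\le\Big(\mathfrak W_f\big((3/2+\sqrt2)/\|A_{\mathrm G}\|_\infty\big)+D_0\Big)\|A_{\mathrm G}\|_\infty+w_*$$ (the first summand being $0$ if $A_{\mathrm G}=0$). (ii) If $a>0$ and $L\ge(3/2+\sqrt2)/a$, then for every generic law there is a graph $\mathrm G$ with $\|A_{\mathrm G}\|_\infty=a$, whose only arc is one self-arc, such that for every initial state $X(0)$, all admissible disturbances and all sequences of estimation errors bounded by $D_0$, some $f\in\mathcal F_L$ yields $\limsup_{t\to\infty}\max_{i}|x_i(t)|=\infty$. Moreover, for each prescribed $n\ge1$, every law on $n$ nodes and every $X(0)\in\mathbb R^n$, there is a graph $\mathrm G$ on $n$ nodes with $L\ge(3/2+\sqrt2)/\|A_{\mathrm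 G}\|_\infty$ such that for all admissible disturbances and all sequences of estimation errors bounded by $D_0$ some $f\in\mathcal F_L$ yields $\limsup_{t\to\infty}\max_i|x_i(t)|=\infty$. -/

import Mathlib

open Filter Topology
open scoped ENNReal

/-- A weighted directed interaction graph on the `n` nodes `Fin n`. `weight i j` is the weight
`a_ij` of the arc `(j, i)`; it is nonzero exactly when this arc is present. Self-arcs are allowed.
The matrix `weight` is the adjacency matrix `A_G`. -/
structure InteractionGraph (n : ℕ) where
  /-- the arc set: `graph.Adj j i` says that `(j, i)` is an arc -/
  graph : Digraph (Fin n)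
  /-- the adjacency matrix `A_G` -/
  weight : Matrix (Fin n) (Fin n) ℝ
  weight_ne_zero_iff : ∀ i j, weight i j ≠ 0 ↔ graph.Adj j i

namespace InteractionGraph

variable {n : ℕ}

open Classical in
/-- The neighbour set `N_i = {j : (j, i) is an arc}`. -/
noncomputable def neighbors (G : InteractionGraph n) (i : Fin n) : Finset (Fin n) :=
  Finset.univ.filter fun j => G.graph.Adj j i

/-- `‖A_G‖_∞ = max_i ∑_{j ∈ N_i} |a_ij|`. -/
noncomputable def infNorm (G : InteractionGraph n) : ℝ :=
  ⨆ i, ∑ j ∈ G.neighbors i, |G.weight i j|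

/-- The graph has exactly one arc, and this arc is a self-arc. -/
def IsSingleSelfLoop (G : InteractionGraph n) : Prop :=
  ∃ k, ∀ j i, G.graph.Adj j i ↔ j = k ∧ i = k

end InteractionGraph

/-- The quasi-norm `lim_{α → ∞} sup_{x, y} |f x - f y| / (|x - y| + α)`, with values in `[0, ∞]`.
The limit always exists, see `tendsto_quasiNorm`. -/
noncomputable def quasiNorm (f : ℝ → ℝ) : ℝ≥0∞ :=
  limsup (fun α : ℝ => ⨆ x : ℝ, ⨆ y : ℝ, ENNReal.ofReal (|f x - f y| / (|x - y| + α))) atTop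

theorem tendsto_quasiNorm (f : ℝ → ℝ) :
    Tendsto (fun α : ℝ => ⨆ x : ℝ, ⨆ y : ℝ, ENNReal.ofReal (|f x - f y| / (|x - y| + α)))
      atTop (𝓝 (quasiNorm f)) := by
  set g : ℝ → ℝ≥0∞ := fun α =>
    ⨆ x : ℝ, ⨆ y : ℝ, ENNReal.ofReal (|f x - f y| / (|x - y| + α)) with hg
  have hanti : Antitone fun α : ℝ => g (max α 1) := by
    intro α β hαβ
    refine iSup_mono fun x => iSup_mono fun y => ENNReal.ofReal_le_ofReal ?_
    have h1 : (0 : ℝ) < max α 1 := lt_of_lt_of_le one_pos (le_max_right _ _)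
    have h2 : max α 1 ≤ max β 1 := max_le_max hαβ le_rfl
    have h3 : 0 ≤ |x - y| := abs_nonneg _
    exact div_le_div_of_nonneg_left (abs_nonneg _) (by linarith) (by linarith)
  have hlim : Tendsto g atTop (𝓝 (⨅ α : ℝ, g (max α 1))) := by
    refine (tendsto_atTop_iInf hanti).congr' ?_
    filter_upwards [eventually_ge_atTop (1 : ℝ)] with α hα
    rw [max_eq_left hα]
  have : quasiNorm f = ⨅ α : ℝ, g (max α 1) := hlim.limsup_eq
  rw [this]
  exact hlim

/-- The uncertainty class `F_L`: all functions `ℝ → ℝ` of quasi-norm at most `L`. -/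
def functionClass (L : ℝ) : Set (ℝ → ℝ) := {f | quasiNorm f ≤ ENNReal.ofReal L}

/-- `𝔚_f(r)`: the infimum of all `c` such that `|f x - f y| ≤ (L + η) |x - y| + c` for all `x, y`,
for some `η > 0` with `L + η < r`. -/
noncomputable def offsetBound (L : ℝ) (f : ℝ → ℝ) (r : ℝ) : ℝ :=
  sInf {c | 0 ≤ c ∧ ∃ η, 0 < η ∧ L + η < r ∧ ∀ x y, |f x - f y| ≤ (L + η) * |x - y| + c}

/-- A global-knowledge/global-decision feedback law on `n` nodes: for every adjacency matrix and
every time `t`, an arbitrary function of the network flow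
`(X(0), …, X(t); Z(0), …, Z(t-1); U(0), …, U(t-1))` with values in `ℝⁿ`. -/
abbrev GlobalLaw (n : ℕ) : Type :=
  Matrix (Fin n) (Fin n) ℝ → (t : ℕ) →
    (Fin (t + 1) → Fin n → ℝ) → (Fin t → Fin n → ℝ) → (Fin t → Fin n → ℝ) → (Fin n → ℝ)

/-- `x, u, z` are the states, inputs and estimates of a closed loop of the network dynamics under
the law `h`, with node dynamics `f`, disturbance `w` bounded by `wstar`, and estimates `z_i(t)` of
`f(x_i(t))` with error at most `D₀`. -/
structure IsClosedLoop {n : ℕ} (h : GlobalLaw n) (G : InteractionGraph n) (f : ℝ → ℝ)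
    (wstar D₀ : ℝ) (w z x u : ℕ → Fin n → ℝ) : Prop where
  disturbance : ∀ t i, |w t i| ≤ wstar
  estimate : ∀ t i, |f (x t i) - z t i| ≤ D₀
  dynamics : ∀ t i,
    x (t + 1) i = ∑ j ∈ G.neighbors i, G.weight i j * f (x t j) + u t i + w t i
  control : ∀ t,
    u t = h G.weight t (fun s => x (s : ℕ)) (fun s => z (s : ℕ)) (fun s => u (s : ℕ))

/-- The law `h` stabilizes the network on `G` with node dynamics `f`: whatever the initial state,
the bounded disturbance and the admissible estimates, states and inputs stay bounded. -/
def Stabilizes {n : ℕ} (h : GlobalLaw n) (G : InteractionGraph n) (f : ℝ → ℝ) : Prop :=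
  ∀ (wstar D₀ : ℝ) (w z x u : ℕ → Fin n → ℝ), 0 < wstar → IsClosedLoop h G f wstar D₀ w z x u →
    ∀ i, BddAbove (Set.range fun t => |x t i| + |u t i|)

/-- From the initial state `X₀`, and for every bounded disturbance `w` and every bounded sequence
`e` of estimation errors, some `f ∈ F_L` makes the closed loop under `h` diverge:
`limsup_t max_i |x_i(t)| = ∞`. -/
def Defeated {n : ℕ} (L : ℝ) (h : GlobalLaw n) (G : InteractionGraph n) (X₀ : Fin n → ℝ) : Prop :=
  ∀ (wstar D₀ : ℝ) (w e : ℕ → Fin n → ℝ), 0 < wstar →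
    (∀ t i, |w t i| ≤ wstar) → (∀ t i, |e t i| ≤ D₀) →
    ∃ f ∈ functionClass L, ∃ z x u : ℕ → Fin n → ℝ,
      IsClosedLoop h G f wstar D₀ w z x u ∧ x 0 = X₀ ∧ (∀ t i, z t i = f (x t i) + e t i) ∧
      limsup (fun t => ((⨆ i, |x t i| : ℝ) : EReal)) atTop = ⊤

/-- The nearest-neighbour feedback law with parameter `ε` (for some way of breaking ties).
At time `0` it is zero. At time `t ≥ 1`, `(v i, s i)` with `s i ≤ t - 1` is a node and a past time
whose state is nearest to `x_i(t)`, the estimate of `f(x_i(t))` is `z_{v i}(s i)`, and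
`u_i(t) = - ∑_{j ∈ N_i} a_ij z_{v j}(s j)`, plus the midpoint of the range of all states up to time
`t` unless every node is within `ε` of its nearest neighbour. -/
def IsNearestNeighborLaw {n : ℕ} (ε : ℝ) (h : GlobalLaw n) : Prop :=
  ∀ G : InteractionGraph n,
    (∀ X Z U, h G.weight 0 X Z U = 0) ∧
    ∀ (t : ℕ), 1 ≤ t → ∀ (X : Fin (t + 1) → Fin n → ℝ) (Z U : Fin t → Fin n → ℝ),
      ∃ (v : Fin n → Fin n) (s : Fin n → Fin t),
        (∀ i j τ, |X (Fin.last t) i - X (s i).castSucc (v i)|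
          ≤ |X (Fin.last t) i - X (Fin.castSucc τ) j|) ∧
        ((∀ k, |X (Fin.last t) k - X (s k).castSucc (v k)| ≤ ε) →
          ∀ i, h G.weight t X Z U i
            = -∑ j ∈ G.neighbors i, G.weight i j * Z (s j) (v j)) ∧
        ((¬ ∀ k, |X (Fin.last t) k - X (s k).castSucc (v k)| ≤ ε) →
          ∀ i, h G.weight t X Z U i
            = -(∑ j ∈ G.neighbors i, G.weight i j * Z (s j) (v j))
              + 1 / 2 * ((⨅ p : Fin (t + 1) × Fin n, X p.1 p.2)
                + ⨆ p : Fin (t + 1) × Fin n, X p.1 p.2))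

/-! Write `l` for the product of the slope and `‖A_G‖_∞`. Up to additive constants, the next state
lies within `l` times the distance to the nearest past state of the centre of the past range. If `ρ`
is the half-length of that range and `H` the largest expansion so far, gaps in the range are at most
`H`, so a new expansion is at most `l H - ρ`. A record expansion `h > H` turns the ratio `p = ρ / H`
into at least `p / (l - p) + 1/2`. With `σ = l - p` the gain is `l / σ + σ - l - 1/2 ≥ 2√l - l -
1/2`, positive for `1 ≤ l < 3/2 + √2`. As `p < l` at every record, a potential built from `H` and
`p` bounds `H`, hence `ρ`. Once the states are bounded, compactness makes the nearest-state
distances tend to zero; the centring term is then switched off and the asymptotic bound remains.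

Conversely, the law sees the value of `f` at a state only one step late. An adversary extends `f`
beyond the past range with slope `L` or `-L`, choosing the sign that drives the next state away from
the centre of the enlarged range. For a suitable `p`, the half-length stays at most `p` times the
last expansion while the expansions grow at least by the factor `a L - p > 1`. These choices agree
on all visited states, and a Lipschitz extension joins them into a single function. -/

/-! ### Boundedness of an expanding range below the threshold. -/

/-- The expression equals `1/2 - (√l - 1)²`, and `(1 + √2/2)² = 3/2 + √2`. -/
theorem two_mul_sqrt_gt {l : ℝ} (h1 : 1 ≤ l) (h2 : l < 3 / 2 + √2) : 0 < 2 * √l - 1 / 2 - l := by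
  have hs : √l ^ 2 = l := Real.sq_sqrt (by linarith)
  have h2' : √2 ^ 2 = (2 : ℝ) := Real.sq_sqrt (by norm_num)
  have hs1 : 1 ≤ √l := Real.one_le_sqrt.2 h1
  have h20 : 0 ≤ √2 := Real.sqrt_nonneg 2
  have hlt : √l < 1 + √2 / 2 := by
    by_contra hc
    push Not at hc
    nlinarith
  nlinarith

/-- A range of half-length `ρ t`, expanded by `h t ≤ (l H t - ρ t)⁺` on at least one side, where
`H` is the running maximum of the expansions, stays bounded if `l < 3/2 + √2`. -/
theorem exists_bound_of_expansion {l : ℝ} (hl1 : 1 ≤ l) (hl2 : l < 3 / 2 + √2) {ρ H h : ℕ → ℝ}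
    (hρ0 : 0 < ρ 0) (hH0 : 0 < H 0) (hh : ∀ t, 0 ≤ h t) (hρl : ∀ t, ρ t + h t / 2 ≤ ρ (t + 1))
    (hρu : ∀ t, ρ (t + 1) ≤ ρ t + h t) (hH : ∀ t, H (t + 1) = max (H t) (h t))
    (hhu : ∀ t, h t ≤ max 0 (l * H t - ρ t)) : ∃ B, ∀ t, ρ t ≤ B := by
  have hρ : ∀ t, 0 < ρ t := by
    intro t
    induction t with
    | zero => exact hρ0
    | succ t ih => linarith [hρl t, hh t]
  have hHp : ∀ t, 0 < H t := by
    intro t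
    induction t with
    | zero => exact hH0
    | succ t ih => rw [hH]; exact lt_max_of_lt_left ih
  -- The least gain of `ρ / H` at a record expansion.
  obtain ⟨d, hd⟩ : ∃ d, d = 2 * √l - 1 / 2 - l := ⟨_, rfl⟩
  have hdpos : 0 < d := hd ▸ two_mul_sqrt_gt hl1 hl2
  have hs : √l ^ 2 = l := Real.sq_sqrt (by linarith)
  -- Bounds the number of records still possible: each raises the ratio by `d`, and none occurs at
  -- ratio `≥ l`. The cap keeps `e` nonnegative.
  set e : ℕ → ℝ := fun t => (l + d - min (ρ t / H t) (l + d)) / d with he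
  have he0 : ∀ t, 0 ≤ e t := fun t =>
    div_nonneg (sub_nonneg.2 (min_le_right _ _)) hdpos.le
  -- A record multiplies `H` by at most `l` and lowers `e` by at least one; otherwise `H` is
  -- unchanged and `e` does not increase.
  have hV : ∀ t, H (t + 1) * l ^ e (t + 1) ≤ H t * l ^ e t := by
    intro t
    have hstep := hH t
    rcases le_or_gt (h t) (H t) with hle | hgt
    · rw [max_eq_left hle] at hstep
      rw [hstep]
      refine mul_le_mul_of_nonneg_left (Real.rpow_le_rpow_of_exponent_le hl1 ?_) (hHp t).le
      simp only [he]
      rw [hstep]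
      have : ρ t / H t ≤ ρ (t + 1) / H t :=
        div_le_div_of_nonneg_right (by linarith [hρl t, hh t]) (hHp t).le
      have := min_le_min_right (l + d) this
      exact div_le_div_of_nonneg_right (by linarith) hdpos.le
    · rw [max_eq_right hgt.le] at hstep
      have hpos : 0 < h t := (hHp t).trans hgt
      have hle : h t ≤ l * H t - ρ t := by
        rcases le_max_iff.1 (hhu t) with h0 | h0
        · linarith
        · exact h0
      obtain ⟨p, hp⟩ : ∃ p, p = ρ t / H t := ⟨_, rfl⟩
      have hpH : ρ t = p * H t := by rw [hp, div_mul_cancel₀ _ (hHp t).ne']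
      have hp0 : 0 < p := hp ▸ div_pos (hρ t) (hHp t)
      have hσH : h t ≤ (l - p) * H t := by rw [hpH] at hle; linarith
      have hσ : 0 < l - p := by
        by_contra hc
        push Not at hc
        nlinarith [hHp t]
      have h1 : p + d ≤ p / (l - p) + 1 / 2 := by
        have : p / (l - p) + 1 / 2 - (p + d) = (√l - (l - p)) ^ 2 / (l - p) := by
          rw [hd]
          field_simp
          ring_nf
          rw [hs]
          ring
        have h3 : 0 ≤ (√l - (l - p)) ^ 2 / (l - p) := by positivity
        linarith
      have h2 : p / (l - p) ≤ ρ t / h t := by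
        rw [div_le_div_iff₀ hσ hpos, hpH]
        nlinarith
      have h3 : ρ t / h t + 1 / 2 ≤ ρ (t + 1) / h t := by
        rw [le_div_iff₀ hpos, add_mul, div_mul_cancel₀ _ hpos.ne']
        linarith [hρl t]
      have hmin : min p (l + d) + d ≤ min (ρ (t + 1) / h t) (l + d) := by
        rw [min_eq_left (by linarith)]
        exact le_min (by linarith) (by linarith)
      have hee : e (t + 1) ≤ e t - 1 := by
        simp only [he]
        rw [hstep, ← hp, div_sub_one hdpos.ne']
        exact div_le_div_of_nonneg_right (by linarith) hdpos.le
      have hl0 : 0 < l := by linarith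
      calc H (t + 1) * l ^ e (t + 1) ≤ (l * H t) * l ^ (e t - 1) := by
            rw [hstep]
            refine mul_le_mul (by linarith [hρ t])
              (Real.rpow_le_rpow_of_exponent_le hl1 hee) (by positivity) ?_
            exact (mul_pos hl0 (hHp t)).le
        _ = H t * l ^ e t := by
            rw [Real.rpow_sub_one hl0.ne']
            field_simp
  have hHb : ∀ t, H t ≤ H 0 * l ^ e 0 := by
    intro t
    have : H t * l ^ e t ≤ H 0 * l ^ e 0 := by
      induction t with
      | zero => exact le_rfl
      | succ t ih => exact (hV t).trans ih
    refine le_trans ?_ this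
    exact le_mul_of_one_le_right (hHp t).le (Real.one_le_rpow hl1 (he0 t))
  -- With `H` bounded, a positive expansion leaves `ρ + h ≤ l H`.
  refine ⟨max (ρ 0) (l * (H 0 * l ^ e 0)), fun t => ?_⟩
  induction t with
  | zero => exact le_max_left _ _
  | succ t ih =>
    have h1 := hρu t
    have h2 := mul_le_mul_of_nonneg_left (hHb t) (by linarith : (0:ℝ) ≤ l)
    rcases le_max_iff.1 (hhu t) with h0 | h0
    · linarith
    · exact le_max_of_le_right (by linarith)

/-- A network whose next states always lie in a fixed ball or within `l d + C` of the centre of the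
range of all past states, where `d` bounds all distances to the nearest past state, is bounded. -/
theorem exists_bound_of_nearest_center {n : ℕ} {x : ℕ → Fin n → ℝ} {lo hi : ℕ → ℝ}
    {l C K : ℝ} (hl1 : 1 ≤ l) (hl2 : l < 3 / 2 + √2) (hC : 0 ≤ C) (hK : 0 < K)
    (hlo : ∀ t, ∀ s ≤ t, ∀ i, lo t ≤ x s i) (hhi : ∀ t, ∀ s ≤ t, ∀ i, x s i ≤ hi t)
    (hlo' : ∀ t, ∃ s ≤ t, ∃ i, lo t = x s i) (hhi' : ∀ t, ∃ s ≤ t, ∃ i, hi t = x s i)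
    (h0 : ∀ i, |x 0 i| ≤ K)
    (hstep : ∀ t, (∀ i, |x (t + 1) i| ≤ K) ∨ (1 ≤ t ∧
      ∀ d, (∀ i, ∃ s < t, ∃ j, |x t i - x s j| ≤ d) →
        ∀ i, |x (t + 1) i - 1 / 2 * (lo t + hi t)| ≤ l * d + C)) :
    ∃ B, ∀ t i, |x t i| ≤ B := by
  have hlom : ∀ t, lo (t + 1) ≤ lo t := fun t => by
    obtain ⟨s, hs, i, h⟩ := hlo' t
    rw [h]; exact hlo _ _ (by omega) _
  have hhim : ∀ t, hi t ≤ hi (t + 1) := fun t => by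
    obtain ⟨s, hs, i, h⟩ := hhi' t
    rw [h]; exact hhi _ _ (by omega) _
  set P : ℕ → ℝ := fun t => max K (hi t) with hP
  set p : ℕ → ℝ := fun t => min (-K) (lo t) with hp
  have hPm : ∀ t, P t ≤ P (t + 1) := fun t => max_le_max_left _ (hhim t)
  have hpm : ∀ t, p (t + 1) ≤ p t := fun t => min_le_min_left _ (hlom t)
  have hPK : ∀ t, K ≤ P t := fun t => le_max_left _ _
  have hpK : ∀ t, p t ≤ -K := fun t => min_le_left _ _
  have hPx : ∀ t, ∀ s ≤ t, ∀ i, x s i ≤ P t := fun t s hs i =>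
    (hhi t s hs i).trans (le_max_right _ _)
  have hpx : ∀ t, ∀ s ≤ t, ∀ i, p t ≤ x s i := fun t s hs i =>
    (min_le_right _ _).trans (hlo t s hs i)
  -- The range is enlarged by the ball of radius `K`, so steps ending in that ball cause no
  -- expansion and a moved endpoint is a new state.
  have hPs : ∀ t, P (t + 1) ≤ P t ∨ ∃ i, P (t + 1) = x (t + 1) i := fun t => by
    obtain ⟨s, hs, i, h⟩ := hhi' (t + 1)
    rcases le_total K (hi (t + 1)) with hk | hk
    · rcases Nat.le_succ_iff.1 hs with hs | hs
      · left
        simp only [hP]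
        rw [max_eq_right hk, h]
        exact hPx t s hs i
      · right
        refine ⟨i, ?_⟩
        simp only [hP]
        rw [max_eq_right hk, h, hs]
    · left
      simp only [hP]
      rw [max_eq_left hk]
      exact hPK t
  have hps : ∀ t, p t ≤ p (t + 1) ∨ ∃ i, p (t + 1) = x (t + 1) i := fun t => by
    obtain ⟨s, hs, i, h⟩ := hlo' (t + 1)
    rcases le_total (lo (t + 1)) (-K) with hk | hk
    · rcases Nat.le_succ_iff.1 hs with hs | hs
      · left
        simp only [hp]
        rw [min_eq_right hk, h]
        exact hpx t s hs i
      · right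
        refine ⟨i, ?_⟩
        simp only [hp]
        rw [min_eq_right hk, h, hs]
    · left
      simp only [hp]
      rw [min_eq_left hk]
      exact hpK t
  have hPe : ∀ t, |P t| ≤ K ∨ ∃ s ≤ t, ∃ j, P t = x s j := fun t => by
    rcases le_total K (hi t) with hk | hk
    · obtain ⟨s, hs, i, hh⟩ := hhi' t
      exact Or.inr ⟨s, hs, i, by rw [← hh]; exact max_eq_right hk⟩
    · have : P t = K := max_eq_left hk
      exact Or.inl (by rw [this, abs_of_pos hK])
  have hpe : ∀ t, |p t| ≤ K ∨ ∃ s ≤ t, ∃ j, p t = x s j := fun t => by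
    rcases le_total (lo t) (-K) with hk | hk
    · obtain ⟨s, hs, i, hh⟩ := hlo' t
      exact Or.inr ⟨s, hs, i, by rw [← hh]; exact min_eq_right hk⟩
    · have : p t = -K := min_eq_left hk
      exact Or.inl (by rw [this, abs_neg, abs_of_pos hK])
  -- Room below the threshold: starting `H` at `C' / (l' - l) + 1` lets `l' H` absorb `l H + C'`.
  set l' : ℝ := (l + (3 / 2 + √2)) / 2 with hl'
  have hll : l < l' := by rw [hl']; linarith
  set h : ℕ → ℝ := fun t => max (P (t + 1) - P t) (p t - p (t + 1)) with hh
  set ρ : ℕ → ℝ := fun t => (P t - p t) / 2 with hρ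
  -- `2 K l` pays for replacing a point of the ball by an initial state, the last `K` for the shift
  -- between the centres of the two ranges.
  set C' : ℝ := C + 2 * K * l + K with hC'
  have hC'0 : 0 ≤ C' := by positivity
  let H : ℕ → ℝ := fun t => Nat.rec (C' / (l' - l) + 1) (fun t r => max r (h t)) t
  have hHs : ∀ t, H (t + 1) = max (H t) (h t) := fun t => rfl
  have hH00 : H 0 = C' / (l' - l) + 1 := rfl
  have hH0 : ∀ t, C' / (l' - l) + 1 ≤ H t := by
    intro t
    induction t with
    | zero => exact le_rfl
    | succ t ih => rw [hHs]; exact le_max_of_le_left ih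
  have hll0 : 0 < l' - l := by linarith
  have hHC : ∀ t, l * H t + C' ≤ l' * H t := by
    intro t
    have h1 : C' / (l' - l) ≤ H t := by linarith [hH0 t]
    rw [div_le_iff₀ hll0] at h1
    linarith
  have hHnn : ∀ t, 0 < H t := fun t => by
    have : 0 ≤ C' / (l' - l) := by positivity
    linarith [hH0 t]
  have hh0 : ∀ t, 0 ≤ h t := fun t => le_max_of_le_left (by linarith [hPm t])
  -- A point newly covered at one step lies within that expansion of the old endpoint, which is a
  -- past state or a point of the ball.
  have hgap : ∀ t y, p t ≤ y → y ≤ P t →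
      ∃ q, |y - q| ≤ H t ∧ (|q| ≤ K ∨ ∃ s ≤ t, ∃ j, q = x s j) := by
    intro t
    induction t with
    | zero =>
      intro y hy1 hy2
      refine ⟨y, by simpa using (hHnn 0).le, Or.inl ?_⟩
      have e1 : P 0 = K := by
        obtain ⟨s, hs, i, hh⟩ := hhi' 0
        obtain rfl : s = 0 := by omega
        exact max_eq_left (hh ▸ (abs_le.1 (h0 i)).2)
      have e2 : p 0 = -K := by
        obtain ⟨s, hs, i, hh⟩ := hlo' 0
        obtain rfl : s = 0 := by omega
        exact min_eq_left (hh ▸ (abs_le.1 (h0 i)).1)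
      exact abs_le.2 ⟨by linarith, by linarith⟩
    | succ t ih =>
      intro y hy1 hy2
      have hhH : h t ≤ H (t + 1) := (hHs t) ▸ le_max_right _ _
      rcases lt_or_ge (P t) y with hy | hy
      · refine ⟨P t, ?_, ?_⟩
        · rw [abs_of_nonneg (by linarith)]
          refine le_trans ?_ hhH
          exact le_max_of_le_left (by linarith)
        · exact (hPe t).imp_right fun ⟨s, hs, j, e⟩ => ⟨s, by omega, j, e⟩
      rcases lt_or_ge y (p t) with hy' | hy'
      · refine ⟨p t, ?_, ?_⟩
        · rw [abs_of_nonpos (by linarith)]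
          refine le_trans ?_ hhH
          exact le_max_of_le_right (by linarith)
        · exact (hpe t).imp_right fun ⟨s, hs, j, e⟩ => ⟨s, by omega, j, e⟩
      obtain ⟨q, hq1, hq2⟩ := ih y hy' hy
      refine ⟨q, hq1.trans ((hHs t) ▸ le_max_left _ _), hq2.imp_right ?_⟩
      rintro ⟨s, hs, j, e⟩
      exact ⟨s, by omega, j, e⟩
  have hnear : ∀ t, 1 ≤ t → ∀ i, ∃ s < t, ∃ j, |x t i - x s j| ≤ H t + 2 * K := by
    intro t ht i
    obtain ⟨t, rfl⟩ : ∃ t', t = t' + 1 := ⟨t - 1, by omega⟩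
    obtain ⟨y, hy1, hy2, hy3⟩ : ∃ y, p t ≤ y ∧ y ≤ P t ∧ |x (t + 1) i - y| ≤ h t ∧
        (y = x (t + 1) i ∨ y = P t ∨ y = p t) := by
      have hpP : p t ≤ P t := by linarith [hpK t, hPK t]
      rcases lt_or_ge (P t) (x (t + 1) i) with hy | hy
      · refine ⟨P t, hpP, le_rfl, ?_, by simp⟩
        rw [abs_of_pos (by linarith)]
        exact le_max_of_le_left (by linarith [hPx (t + 1) (t + 1) le_rfl i])
      rcases lt_or_ge (x (t + 1) i) (p t) with hy' | hy'
      · refine ⟨p t, le_rfl, hpP, ?_, by simp⟩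
        rw [abs_of_neg (by linarith)]
        exact le_max_of_le_right (by linarith [hpx (t + 1) (t + 1) le_rfl i])
      · exact ⟨_, hy', hy, by simpa using hh0 t, by simp⟩
    have key : ∃ q, |x (t + 1) i - q| ≤ H (t + 1) ∧ (|q| ≤ K ∨ ∃ s ≤ t, ∃ j, q = x s j) := by
      have hm1 : H t ≤ H (t + 1) := (hHs t) ▸ le_max_left _ _
      have hm2 : h t ≤ H (t + 1) := (hHs t) ▸ le_max_right _ _
      rcases hy3 with ⟨hy3, rfl | rfl | rfl⟩
      · obtain ⟨q, hq1, hq2⟩ := hgap t _ hy1 hy2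
        exact ⟨q, hq1.trans hm1, hq2⟩
      · refine ⟨P t, hy3.trans hm2, ?_⟩
        exact hPe t
      · refine ⟨p t, hy3.trans hm2, ?_⟩
        exact hpe t
    obtain ⟨q, hq1, hq2 | ⟨s, hs, j, rfl⟩⟩ := key
    · refine ⟨0, by omega, i, ?_⟩
      have h1 := h0 i
      rw [abs_le] at *
      constructor <;> linarith
    · exact ⟨s, by omega, j, by linarith⟩
  have hexp : ∀ t, h t ≤ max 0 (l' * H t - ρ t) := by
    intro t
    rcases hstep t with hb | ⟨ht, hb⟩
    · refine le_max_of_le_left (max_le ?_ ?_)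
      · rcases hPs t with h1 | ⟨i, h1⟩
        · linarith
        · linarith [(abs_le.1 (hb i)).2, hPK t]
      · rcases hps t with h1 | ⟨i, h1⟩
        · linarith
        · linarith [(abs_le.1 (hb i)).1, hpK t]
    · have hb := hb _ (hnear t ht)
      have hc : |(P t + p t) / 2 - 1 / 2 * (lo t + hi t)| ≤ K := by
        obtain ⟨i, -⟩ : ∃ i : Fin n, True := by
          obtain ⟨s, hs, i, -⟩ := hhi' t
          exact ⟨i, trivial⟩
        have e1 := hlo t 0 (by omega) i
        have e2 := hhi t 0 (by omega) i
        have e3 := abs_le.1 (h0 i)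
        have e4 : hi t ≤ P t := le_max_right _ _
        have e5 : p t ≤ lo t := min_le_right _ _
        have e6 : P t ≤ hi t + 2 * K := max_le (by linarith) (by linarith)
        have e7 : lo t - 2 * K ≤ p t := le_min (by linarith) (by linarith)
        rw [abs_le]
        constructor <;> linarith
      have hHC := hHC t
      have hc := abs_le.1 hc
      refine max_le ?_ ?_
      · rcases hPs t with h1 | ⟨i, h1⟩
        · exact le_max_of_le_left (by linarith)
        · refine le_max_of_le_right ?_
          have := (abs_le.1 (hb i)).2
          simp only [hρ]
          linarith
      · rcases hps t with h1 | ⟨i, h1⟩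
        · exact le_max_of_le_left (by linarith)
        · refine le_max_of_le_right ?_
          have := (abs_le.1 (hb i)).1
          simp only [hρ]
          linarith
  have hA : ∀ t, P (t + 1) - P t ≤ h t := fun t => le_max_left _ _
  have hB : ∀ t, p t - p (t + 1) ≤ h t := fun t => le_max_right _ _
  obtain ⟨B, hB⟩ := exists_bound_of_expansion (l := l') (ρ := ρ) (H := H) (h := h) (by linarith)
    (by rw [hl']; linarith) (by simp only [hρ]; linarith [hpK 0, hPK 0]) (hHnn 0) hh0
    (fun t => by
      have : h t ≤ (P (t + 1) - P t) + (p t - p (t + 1)) :=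
        max_le (by linarith [hpm t]) (by linarith [hPm t])
      simp only [hρ]; linarith)
    (fun t => by simp only [hρ]; linarith [hA t, hB t]) hHs hexp
  refine ⟨2 * B, fun t i => ?_⟩
  have := hB t
  simp only [hρ] at this
  rw [abs_le]
  constructor
  · linarith [hpx t t le_rfl i, hPK t]
  · linarith [hPx t t le_rfl i, hpK t]

/-! ### Estimates from the matrix norm and the quasi-norm. -/

namespace InteractionGraph

variable {n : ℕ}

theorem sum_neighbors (G : InteractionGraph n) (i : Fin n) (g : Fin n → ℝ) :
    ∑ j ∈ G.neighbors i, G.weight i j * g j = ∑ j, G.weight i j * g j := by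
  classical
  refine Finset.sum_subset (Finset.subset_univ _) fun j _ hj => ?_
  have : ¬ G.graph.Adj j i := by simpa [neighbors] using hj
  rw [← G.weight_ne_zero_iff, not_not] at this
  rw [this, zero_mul]

theorem sum_abs_le_infNorm (G : InteractionGraph n) (i : Fin n) :
    ∑ j ∈ G.neighbors i, |G.weight i j| ≤ G.infNorm :=
  le_ciSup (f := fun i => ∑ j ∈ G.neighbors i, |G.weight i j|) (Set.finite_range _).bddAbove i

theorem infNorm_nonneg (G : InteractionGraph n) : 0 ≤ G.infNorm :=
  Real.iSup_nonneg fun _ => Finset.sum_nonneg fun _ _ => abs_nonneg _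

theorem abs_sum_weight_mul_le (G : InteractionGraph n) (i : Fin n) {g : Fin n → ℝ} {B : ℝ}
    (hB : 0 ≤ B) (hg : ∀ j, |g j| ≤ B) :
    |∑ j ∈ G.neighbors i, G.weight i j * g j| ≤ B * G.infNorm :=
  calc |∑ j ∈ G.neighbors i, G.weight i j * g j|
      ≤ ∑ j ∈ G.neighbors i, |G.weight i j| * B := by
        refine (Finset.abs_sum_le_sum_abs _ _).trans (Finset.sum_le_sum fun j _ => ?_)
        rw [abs_mul]
        exact mul_le_mul_of_nonneg_left (hg j) (abs_nonneg _)
    _ = B * ∑ j ∈ G.neighbors i, |G.weight i j| := by rw [← Finset.sum_mul, mul_comm]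
    _ ≤ B * G.infNorm := mul_le_mul_of_nonneg_left (G.sum_abs_le_infNorm i) hB

end InteractionGraph

theorem exists_abs_sub_le_of_mem_functionClass {L η : ℝ} (hη : 0 < η) (hL : 0 < L) {f : ℝ → ℝ}
    (hf : f ∈ functionClass L) :
    ∃ c, 0 ≤ c ∧ ∀ x y, |f x - f y| ≤ (L + η) * |x - y| + c := by
  have h1 : quasiNorm f < ENNReal.ofReal (L + η) :=
    lt_of_le_of_lt hf ((ENNReal.ofReal_lt_ofReal_iff (by linarith)).2 (by linarith))
  obtain ⟨α, hα, hα0⟩ := (((tendsto_quasiNorm f).eventually (gt_mem_nhds h1)).and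
    (eventually_gt_atTop (0 : ℝ))).exists
  refine ⟨(L + η) * α, by positivity, fun x y => ?_⟩
  have h2 : ENNReal.ofReal (|f x - f y| / (|x - y| + α)) ≤ ENNReal.ofReal (L + η) :=
    (le_iSup₂ (f := fun x y : ℝ => ENNReal.ofReal (|f x - f y| / (|x - y| + α))) x y).trans hα.le
  rw [ENNReal.ofReal_le_ofReal_iff (by linarith), div_le_iff₀ (by positivity)] at h2
  linarith

theorem mem_functionClass_of_lipschitz {L : ℝ} {f : ℝ → ℝ}
    (hf : ∀ x y, |f x - f y| ≤ L * |x - y|) : f ∈ functionClass L := by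
  have hL : 0 ≤ L := by simpa using (abs_nonneg _).trans (hf 1 0)
  refine le_of_tendsto (tendsto_quasiNorm f) ?_
  filter_upwards [eventually_gt_atTop (0 : ℝ)] with α hα
  refine iSup₂_le fun x y => ENNReal.ofReal_le_ofReal ?_
  have : 0 < |x - y| + α := by positivity
  rw [div_le_iff₀ this]
  nlinarith [hf x y]

/-! ### The nearest-neighbour law. -/

theorem exists_isNearestNeighborLaw (n : ℕ) (ε : ℝ) : ∃ h : GlobalLaw n, IsNearestNeighborLaw ε h := by
  classical
  have key : ∀ (W : Matrix (Fin n) (Fin n) ℝ) (t : ℕ) (X : Fin (t + 1) → Fin n → ℝ)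
      (Z _U : Fin t → Fin n → ℝ), ∃ u : Fin n → ℝ, (t = 0 → u = 0) ∧ (1 ≤ t →
      ∃ (v : Fin n → Fin n) (s : Fin n → Fin t),
        (∀ i j τ, |X (Fin.last t) i - X (s i).castSucc (v i)|
          ≤ |X (Fin.last t) i - X (Fin.castSucc τ) j|) ∧
        ((∀ k, |X (Fin.last t) k - X (s k).castSucc (v k)| ≤ ε) →
          ∀ i, u i = -∑ j, W i j * Z (s j) (v j)) ∧
        ((¬ ∀ k, |X (Fin.last t) k - X (s k).castSucc (v k)| ≤ ε) →
          ∀ i, u i = -(∑ j, W i j * Z (s j) (v j))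
              + 1 / 2 * ((⨅ p : Fin (t + 1) × Fin n, X p.1 p.2)
                + ⨆ p : Fin (t + 1) × Fin n, X p.1 p.2))) := by
    intro W t X Z _
    rcases Nat.eq_zero_or_pos t with rfl | ht
    · exact ⟨0, fun _ => rfl, fun h => absurd h (by omega)⟩
    · have hmin : ∀ i : Fin n, ∃ q : Fin n × Fin t, ∀ q' : Fin n × Fin t,
          |X (Fin.last t) i - X q.2.castSucc q.1| ≤ |X (Fin.last t) i - X q'.2.castSucc q'.1| := by
        intro i
        have : Nonempty (Fin n × Fin t) := ⟨(i, ⟨0, ht⟩)⟩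
        exact Finite.exists_min fun q : Fin n × Fin t =>
          |X (Fin.last t) i - X q.2.castSucc q.1|
      choose q hq using hmin
      by_cases hc : ∀ k, |X (Fin.last t) k - X (q k).2.castSucc (q k).1| ≤ ε
      · exact ⟨fun i => -∑ j, W i j * Z (q j).2 (q j).1, fun h => by omega, fun _ =>
          ⟨fun i => (q i).1, fun i => (q i).2, fun i j τ => hq i (j, τ), fun _ _ => rfl,
            fun h => absurd hc h⟩⟩
      · exact ⟨fun i => -(∑ j, W i j * Z (q j).2 (q j).1)
              + 1 / 2 * ((⨅ p : Fin (t + 1) × Fin n, X p.1 p.2)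
                + ⨆ p : Fin (t + 1) × Fin n, X p.1 p.2), fun h => by omega, fun _ =>
          ⟨fun i => (q i).1, fun i => (q i).2, fun i j τ => hq i (j, τ), fun h => absurd h hc,
            fun _ _ => rfl⟩⟩
  choose h h1 h2 using key
  refine ⟨h, fun G => ⟨fun X Z U => h1 _ _ _ _ _ rfl, fun t ht X Z U => ?_⟩⟩
  simp only [G.sum_neighbors]
  exact h2 G.weight t X Z U ht

/-- One step of a closed loop under the nearest-neighbour law. -/
theorem IsNearestNeighborLaw.step {n : ℕ} {ε : ℝ} {h : GlobalLaw n} (hh : IsNearestNeighborLaw ε h)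
    {G : InteractionGraph n} {f : ℝ → ℝ} {wstar D₀ : ℝ} {w z x u : ℕ → Fin n → ℝ}
    (hcl : IsClosedLoop h G f wstar D₀ w z x u) {l c : ℝ} (hl : 0 ≤ l) (hc : 0 ≤ c)
    (hf : ∀ x y, |f x - f y| ≤ l * |x - y| + c) {t : ℕ} (ht : 1 ≤ t) {d : ℝ} (hd0 : 0 ≤ d)
    (hd : ∀ i, ∃ s < t, ∃ j, |x t i - x s j| ≤ d) :
    (d ≤ ε → ∀ i, |x (t + 1) i| ≤ (l * d + c + D₀) * G.infNorm + wstar) ∧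
    ((∀ i, |x (t + 1) i| ≤ (l * ε + c + D₀) * G.infNorm + wstar) ∨
      ∀ i, |x (t + 1) i - 1 / 2 * ((⨅ p : Fin (t + 1) × Fin n, x p.1 p.2)
        + ⨆ p : Fin (t + 1) × Fin n, x p.1 p.2)| ≤ (l * d + c + D₀) * G.infNorm + wstar) := by
  obtain ⟨v, s, hmin, h1, h2⟩ := (hh G).2 t ht (fun s => x (s : ℕ)) (fun s => z (s : ℕ))
    (fun s => u (s : ℕ))
  simp only [Fin.val_last, Fin.val_castSucc] at hmin h1 h2
  have hdd : ∀ i, |x t i - x (s i) (v i)| ≤ d := fun i => by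
    obtain ⟨τ, hτ, j, hj⟩ := hd i
    exact (hmin i j ⟨τ, hτ⟩).trans hj
  -- `d'` is separate from `d` because the branch without centring uses `ε` instead.
  have hsum : ∀ d', 0 ≤ d' → (∀ i, |x t i - x (s i) (v i)| ≤ d') → ∀ i,
      |∑ j ∈ G.neighbors i, G.weight i j * (f (x t j) - z (s j) (v j))|
        ≤ (l * d' + c + D₀) * G.infNorm := by
    intro d' hd' hdd' i
    have hD : 0 ≤ D₀ := (abs_nonneg _).trans (hcl.estimate 0 i)
    refine G.abs_sum_weight_mul_le i (by positivity) fun j => ?_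
    have e1 := hf (x t j) (x (s j) (v j))
    have e2 := hcl.estimate (s j) (v j)
    have e3 := mul_le_mul_of_nonneg_left (hdd' j) hl
    have e4 := abs_sub_le (f (x t j)) (f (x (s j) (v j))) (z (s j) (v j))
    linarith
  have hdyn : ∀ i m, u t i = -(∑ j ∈ G.neighbors i, G.weight i j * z (s j) (v j)) + m →
      x (t + 1) i - m =
        ∑ j ∈ G.neighbors i, G.weight i j * (f (x t j) - z (s j) (v j)) + w t i := by
    intro i m hu
    rw [hcl.dynamics, hu]
    simp only [mul_sub, Finset.sum_sub_distrib]
    ring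
  have hbd : ∀ i m d', 0 ≤ d' → (∀ i, |x t i - x (s i) (v i)| ≤ d') →
      u t i = -(∑ j ∈ G.neighbors i, G.weight i j * z (s j) (v j)) + m →
      |x (t + 1) i - m| ≤ (l * d' + c + D₀) * G.infNorm + wstar := by
    intro i m d' hd' hdd' hu
    rw [hdyn i m hu]
    exact (abs_add_le _ _).trans (add_le_add (hsum d' hd' hdd' i) (hcl.disturbance t i))
  refine ⟨fun hde i => ?_, ?_⟩
  · have := hbd i 0 d hd0 hdd (by
      rw [hcl.control, add_zero]
      exact h1 (fun k => (hdd k).trans hde) i)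
    simpa using this
  · by_cases hm : ∀ k, |x t k - x (s k) (v k)| ≤ ε
    · refine Or.inl fun i => ?_
      have := hbd i 0 ε ((abs_nonneg _).trans (hm i)) hm (by
        rw [hcl.control, add_zero]
        exact h1 hm i)
      simpa using this
    · refine Or.inr fun i => hbd i _ d hd0 hdd ?_
      rw [hcl.control]
      exact h2 hm i

/-- All closed loops of the nearest-neighbour law below the threshold have bounded states. -/
theorem IsNearestNeighborLaw.exists_bound {n : ℕ} {ε : ℝ} (hε : 0 < ε) {h : GlobalLaw n}
    (hh : IsNearestNeighborLaw ε h) {G : InteractionGraph n} {f : ℝ → ℝ} {wstar D₀ : ℝ}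
    {w z x u : ℕ → Fin n → ℝ} (hw : 0 < wstar) (hcl : IsClosedLoop h G f wstar D₀ w z x u)
    {l c : ℝ} (hl : 0 ≤ l) (hc : 0 ≤ c) (hf : ∀ x y, |f x - f y| ≤ l * |x - y| + c)
    (hlG : l * G.infNorm < 3 / 2 + √2) : ∃ B, ∀ t i, |x t i| ≤ B := by
  rcases Nat.eq_zero_or_pos n with rfl | hn
  · exact ⟨0, fun _ i => i.elim0⟩
  have : Nonempty (Fin n) := ⟨⟨0, hn⟩⟩
  have hD : 0 ≤ D₀ := (abs_nonneg _).trans (hcl.estimate 0 ⟨0, hn⟩)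
  have hG := G.infNorm_nonneg
  have h20 : 0 ≤ √2 := Real.sqrt_nonneg 2
  obtain ⟨K₀, hK₀⟩ := (Set.finite_range fun i => |x 0 i|).bddAbove
  obtain ⟨K₁, hK₁⟩ := (Set.finite_range fun i => |x 1 i|).bddAbove
  set K₂ := (l * ε + c + D₀) * G.infNorm + wstar with hK₂
  have hK₂0 : 0 < K₂ := by positivity
  -- The potential argument needs a factor at least one. The radius also covers time `1`, before
  -- which the law has no estimates.
  refine exists_bound_of_nearest_center (l := max 1 (l * G.infNorm))
    (C := (c + D₀) * G.infNorm + wstar) (K := max K₂ (max K₀ K₁))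
    (lo := fun t => ⨅ p : Fin (t + 1) × Fin n, x p.1 p.2)
    (hi := fun t => ⨆ p : Fin (t + 1) × Fin n, x p.1 p.2)
    (le_max_left _ _) (max_lt (by linarith) hlG) (by positivity) (lt_max_of_lt_left hK₂0)
    (fun t s hs i => ?_) (fun t s hs i => ?_) (fun t => ?_) (fun t => ?_) (fun i => ?_)
    (fun t => ?_)
  · exact ciInf_le (f := fun p : Fin (t + 1) × Fin n => x p.1 p.2) (Set.finite_range _).bddBelow
      (⟨s, by omega⟩, i)
  · exact le_ciSup (f := fun p : Fin (t + 1) × Fin n => x p.1 p.2) (Set.finite_range _).bddAbove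
      (⟨s, by omega⟩, i)
  · obtain ⟨p, hp⟩ := exists_eq_ciInf_of_finite (f := fun p : Fin (t + 1) × Fin n => x p.1 p.2)
    exact ⟨p.1, by omega, p.2, hp.symm⟩
  · obtain ⟨p, hp⟩ := exists_eq_ciSup_of_finite (f := fun p : Fin (t + 1) × Fin n => x p.1 p.2)
    exact ⟨p.1, by omega, p.2, hp.symm⟩
  · exact (hK₀ ⟨i, rfl⟩).trans ((le_max_left _ _).trans (le_max_right _ _))
  · rcases Nat.eq_zero_or_pos t with rfl | ht
    · exact Or.inl fun i => (hK₁ ⟨i, rfl⟩).trans ((le_max_right _ _).trans (le_max_right _ _))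
    · by_cases hb : ∀ i, |x (t + 1) i| ≤ K₂
      · exact Or.inl fun i => (hb i).trans (le_max_left _ _)
      · refine Or.inr ⟨ht, fun d hd i => ?_⟩
        have hd0 : 0 ≤ d := by
          obtain ⟨_, _, _, h⟩ := hd i
          exact (abs_nonneg _).trans h
        have := ((hh.step hcl hl hc hf ht hd0 hd).2.resolve_left hb) i
        have h3 := mul_le_mul_of_nonneg_right (le_max_right 1 (l * G.infNorm)) hd0
        refine this.trans ?_
        linarith

/-- In a bounded sequence of states, the distance to the nearest past state tends to zero. -/
theorem eventually_exists_past_near {n : ℕ} {x : ℕ → Fin n → ℝ} {B : ℝ}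
    (hB : ∀ t i, |x t i| ≤ B) {d : ℝ} (hd : 0 < d) :
    ∀ᶠ t in atTop, ∀ i, ∃ s < t, ∃ j, |x t i - x s j| ≤ d := by
  rw [eventually_all]
  intro i
  by_contra hcon
  obtain ⟨φ, hφ, hφ'⟩ := extraction_of_frequently_atTop (not_eventually.1 hcon)
  obtain ⟨a, -, ψ, hψ, hlim⟩ := (isCompact_Icc (a := -B) (b := B)).tendsto_subseq
    (x := fun m => x (φ m) i) (fun m => abs_le.1 (hB _ _))
  obtain ⟨N, hN⟩ := Metric.cauchySeq_iff'.1 hlim.cauchySeq d hd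
  -- In a convergent subsequence, the node is eventually close to its own past.
  refine hφ' (ψ (N + 1)) ⟨φ (ψ N), hφ (hψ (Nat.lt_succ_self N)), i, ?_⟩
  have := hN (N + 1) (by omega)
  rw [Real.dist_eq] at this
  exact this.le

theorem IsNearestNeighborLaw.eventually_abs_le {n : ℕ} {ε : ℝ} (hε : 0 < ε) {h : GlobalLaw n}
    (hh : IsNearestNeighborLaw ε h) {G : InteractionGraph n} {f : ℝ → ℝ} {wstar D₀ : ℝ}
    {w z x u : ℕ → Fin n → ℝ} (hw : 0 < wstar) (hcl : IsClosedLoop h G f wstar D₀ w z x u)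
    {l c : ℝ} (hl : 0 ≤ l) (hc : 0 ≤ c) (hf : ∀ x y, |f x - f y| ≤ l * |x - y| + c)
    (hlG : l * G.infNorm < 3 / 2 + √2) {δ : ℝ} (hδ : 0 < δ) (i : Fin n) :
    ∀ᶠ t in atTop, |x t i| ≤ (c + D₀) * G.infNorm + wstar + δ := by
  obtain ⟨B, hB⟩ := hh.exists_bound hε hw hcl hl hc hf hlG
  have hG := G.infNorm_nonneg
  set d := min ε (δ / (l * G.infNorm + 1)) with hd
  have hd0 : 0 < d := lt_min hε (by positivity)
  have hdδ : l * G.infNorm * d ≤ δ := by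
    have h1 : d ≤ δ / (l * G.infNorm + 1) := min_le_right _ _
    rw [le_div_iff₀ (by positivity)] at h1
    nlinarith
  have hev := (eventually_exists_past_near hB hd0).and (eventually_ge_atTop 1)
  obtain ⟨N, hN⟩ := eventually_atTop.1 hev
  filter_upwards [eventually_ge_atTop (N + 1)] with t ht
  obtain ⟨t, rfl⟩ : ∃ t', t = t' + 1 := ⟨t - 1, by omega⟩
  obtain ⟨hd1, ht1⟩ := hN t (by omega)
  have := (hh.step hcl hl hc hf ht1 hd0.le hd1).1 (min_le_left _ _) i
  linarith

theorem exists_slope {L M r : ℝ} (hM : 0 ≤ M) (h : L * M < r) : ∃ η, 0 < η ∧ (L + η) * M < r := by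
  refine ⟨(r - L * M) / (2 * (M + 1)), div_pos (by linarith) (by positivity), ?_⟩
  have h1 : (r - L * M) / (2 * (M + 1)) * M ≤ (r - L * M) / 2 := by
    rw [div_mul_eq_mul_div, div_le_div_iff₀ (by positivity) (by positivity)]
    nlinarith
  linarith

theorem IsNearestNeighborLaw.stabilizes {n : ℕ} {ε L : ℝ} (hε : 0 < ε) (hL : 0 < L)
    {h : GlobalLaw n} (hh : IsNearestNeighborLaw ε h) {G : InteractionGraph n}
    (hG : L * G.infNorm < 3 / 2 + √2) {f : ℝ → ℝ} (hf : f ∈ functionClass L) :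
    Stabilizes h G f := by
  intro wstar D₀ w z x u hw hcl i
  obtain ⟨η, hη, hηG⟩ := exists_slope G.infNorm_nonneg hG
  obtain ⟨c, hc, hfc⟩ := exists_abs_sub_le_of_mem_functionClass hη hL hf
  have hl : 0 ≤ L + η := by positivity
  obtain ⟨B, hB⟩ := hh.exists_bound hε hw hcl hl hc hfc hηG
  have hB0 : 0 ≤ B := (abs_nonneg _).trans (hB 0 i)
  have hfB : ∀ t j, |f (x t j)| ≤ |f 0| + ((L + η) * B + c) := fun t j => by
    have e1 := hfc (x t j) 0
    have e2 := mul_le_mul_of_nonneg_left (hB t j) hl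
    have e3 := abs_sub_abs_le_abs_sub (f (x t j)) (f 0)
    rw [sub_zero] at e1
    linarith
  refine ⟨B + (B + (|f 0| + ((L + η) * B + c)) * G.infNorm + wstar), ?_⟩
  rintro _ ⟨t, rfl⟩
  have e1 : u t i = x (t + 1) i - ∑ j ∈ G.neighbors i, G.weight i j * f (x t j) - w t i := by
    rw [hcl.dynamics]; ring
  have e2 := G.abs_sum_weight_mul_le i (by positivity) (hfB t)
  refine add_le_add (hB t i) ?_
  rw [e1]
  refine (abs_sub _ _).trans (add_le_add ((abs_sub _ _).trans (add_le_add (hB _ i) e2))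
    (hcl.disturbance t i))

theorem IsNearestNeighborLaw.limsup_le {n : ℕ} {ε L : ℝ} (hε : 0 < ε) (hL : 0 < L)
    {h : GlobalLaw n} (hh : IsNearestNeighborLaw ε h) {G : InteractionGraph n}
    (hG : L * G.infNorm < 3 / 2 + √2) {f : ℝ → ℝ} (hf : f ∈ functionClass L)
    {wstar D₀ : ℝ} {w z x u : ℕ → Fin n → ℝ} (hw : 0 < wstar)
    (hcl : IsClosedLoop h G f wstar D₀ w z x u) (i : Fin n) :
    limsup (fun t => ((|x t i| : ℝ) : EReal)) atTop ≤
      (((offsetBound L f ((3 / 2 + √2) / G.infNorm) + D₀) * G.infNorm + wstar : ℝ) : EReal) := by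
  rw [← EReal.le_of_forall_lt_iff_le]
  intro b hb
  rw [EReal.coe_lt_coe_iff] at hb
  obtain ⟨η, hη, hηG⟩ := exists_slope G.infNorm_nonneg hG
  obtain ⟨c, hc, hfc⟩ := exists_abs_sub_le_of_mem_functionClass hη hL hf
  suffices ∀ᶠ t in atTop, |x t i| ≤ b from
    Filter.limsup_le_of_le (h := this.mono fun t ht => EReal.coe_le_coe ht)
  rcases G.infNorm_nonneg.eq_or_lt with h0 | h0
  -- Here the threshold is a division by zero with value `0`; the offset is irrelevant, being
  -- multiplied by the zero norm.
  · rw [← h0, mul_zero] at hb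
    have := hh.eventually_abs_le hε hw hcl (by positivity) hc hfc hηG (sub_pos.2 hb) i
    filter_upwards [this] with t ht
    rw [← h0, mul_zero] at ht
    linarith
  · set S := {c | 0 ≤ c ∧ ∃ η, 0 < η ∧ L + η < (3 / 2 + √2) / G.infNorm ∧
      ∀ x y, |f x - f y| ≤ (L + η) * |x - y| + c} with hS
    have hne : S.Nonempty := ⟨c, hc, η, hη, (lt_div_iff₀ h0).2 hηG, hfc⟩
    set q := (offsetBound L f ((3 / 2 + √2) / G.infNorm) + D₀) * G.infNorm + wstar with hq
    obtain ⟨c', ⟨hc', η', hη', hηG', hfc'⟩, hlt⟩ := exists_lt_of_csInf_lt hne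
      (show sInf S < sInf S + (b - q) / 2 / G.infNorm from
        lt_add_of_pos_right _ (div_pos (by linarith) h0))
    have := hh.eventually_abs_le hε hw hcl (by positivity) hc' hfc' ((lt_div_iff₀ h0).1 hηG')
      (δ := (b - q) / 2) (by linarith) i
    filter_upwards [this] with t ht
    have h1 := mul_lt_mul_of_pos_right hlt h0
    rw [add_mul, div_mul_cancel₀ _ h0.ne'] at h1
    have h2 : q = (sInf S + D₀) * G.infNorm + wstar := rfl
    linarith

/-! ### Runs on uniform self-loops and their causality. -/

/-- `x, u` are the states and inputs of the closed loop with initial state `X₀`, disturbance `w` and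
estimation errors `e`. -/
structure IsRun {n : ℕ} (h : GlobalLaw n) (W : Matrix (Fin n) (Fin n) ℝ) (a : ℝ) (X₀ : Fin n → ℝ)
    (w e : ℕ → Fin n → ℝ) (f : ℝ → ℝ) (x u : ℕ → Fin n → ℝ) : Prop where
  init : x 0 = X₀
  dynamics : ∀ t i, x (t + 1) i = a * f (x t i) + u t i + w t i
  control : ∀ t, u t = h W t (fun s => x (s : ℕ)) (fun s i => f (x (s : ℕ) i) + e (s : ℕ) i)
    (fun s => u (s : ℕ))

section Run

variable {n : ℕ} {h : GlobalLaw n} {W : Matrix (Fin n) (Fin n) ℝ} {a : ℝ} {X₀ : Fin n → ℝ}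
  {w e : ℕ → Fin n → ℝ}

/-- Causality: neither the state nor the input at a given time uses the values of `f` at states of
that time. -/
theorem IsRun.congr {f g : ℝ → ℝ} {x u y v : ℕ → Fin n → ℝ} (hf : IsRun h W a X₀ w e f x u)
    (hg : IsRun h W a X₀ w e g y v) (t : ℕ) (hfg : ∀ s < t, ∀ i, g (x s i) = f (x s i)) :
    ∀ s ≤ t, x s = y s ∧ u s = v s := by
  intro s
  induction s using Nat.strong_induction_on with
  | _ s ih =>
    intro hs
    have hx : x s = y s := by
      rcases s with _ | s
      · rw [hf.init, hg.init]
      · funext i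
        obtain ⟨h1, h2⟩ := ih s (by omega) (by omega)
        rw [hf.dynamics, hg.dynamics, ← h1, ← h2, hfg s (by omega)]
    refine ⟨hx, ?_⟩
    rw [hf.control, hg.control]
    congr 1
    · funext r
      rcases Nat.lt_succ_iff_lt_or_eq.1 r.2 with hr | hr
      · exact (ih r hr (by omega)).1
      · rw [hr, hx]
    · funext r i
      rw [← (ih r r.2 (by omega)).1, hfg r (by omega)]
    · funext r
      exact (ih r r.2 (by omega)).2

variable (h W a X₀ w e) in
theorem exists_isRun (f : ℝ → ℝ) : ∃ x u, IsRun h W a X₀ w e f x u := by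
  classical
  let inp : ℕ → (ℕ → Fin n → ℝ) × (ℕ → Fin n → ℝ) → Fin n → ℝ := fun t q =>
    h W t (fun s => q.1 s) (fun s i => f (q.1 s i) + e s i) (fun s => q.2 s)
  -- Stage `t` is final for states up to time `t` but for inputs only before time `t`.
  let hist : ℕ → (ℕ → Fin n → ℝ) × (ℕ → Fin n → ℝ) := fun t =>
    Nat.rec (fun _ => X₀, fun _ => 0) (fun t q =>
      (Function.update q.1 (t + 1) (fun i => a * f (q.1 t i) + inp t q i + w t i),
        Function.update q.2 t (inp t q))) t
  have hs : ∀ t, hist (t + 1) = (Function.update (hist t).1 (t + 1)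
      (fun i => a * f ((hist t).1 t i) + inp t (hist t) i + w t i),
        Function.update (hist t).2 t (inp t (hist t))) := fun _ => rfl
  have hx : ∀ d s, (hist (s + d)).1 s = (hist s).1 s := by
    intro d s
    induction d with
    | zero => rfl
    | succ d ih =>
      rw [← add_assoc, hs]
      simp only
      rw [Function.update_of_ne (by omega), ih]
  have hu : ∀ d s, (hist (s + 1 + d)).2 s = (hist (s + 1)).2 s := by
    intro d s
    induction d with
    | zero => rfl
    | succ d ih =>
      rw [← add_assoc, hs]
      simp only
      rw [Function.update_of_ne (by omega), ih]
  have hx' : ∀ s t, s ≤ t → (hist t).1 s = (hist s).1 s := fun s t hst => by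
    have := hx (t - s) s
    rwa [Nat.add_sub_cancel' hst] at this
  have hu' : ∀ s t, s < t → (hist t).2 s = (hist (s + 1)).2 s := fun s t hst => by
    have := hu (t - (s + 1)) s
    rwa [Nat.add_sub_cancel' (Nat.succ_le_of_lt hst)] at this
  have hinp : ∀ t, (hist (t + 1)).2 t = inp t (hist t) := fun t => by
    rw [hs]; exact Function.update_self ..
  refine ⟨fun t => (hist t).1 t, fun t => (hist (t + 1)).2 t, rfl, fun t i => ?_, fun t => ?_⟩
  · rw [hinp, hs]
    simp only
    rw [Function.update_self]
  · rw [hinp]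
    simp only [inp]
    congr 1
    · funext r
      exact hx' _ _ (by omega)
    · funext r i
      rw [hx' _ _ (by omega : (r : ℕ) ≤ t)]
    · funext r
      exact hu' _ _ r.2

end Run

/-! ### The adversary. -/

/-- Motion splits into a part inside `[m, M]` and a change of distance to it; this keeps the
modified function `L`-Lipschitz. -/
theorem abs_clamp_sub_add_le (m M x y : ℝ) (hmM : m ≤ M) :
    |max m (min x M) - max m (min y M)|
      + |(|x - max m (min x M)|) - (|y - max m (min y M)|)| ≤ |x - y| := by
  rcases le_total x M with h1 | h1 <;> rcases le_total y M with h2 | h2 <;>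
  rcases le_total m x with h3 | h3 <;> rcases le_total m y with h4 | h4 <;>
  simp only [min_eq_left, min_eq_right, max_eq_left, max_eq_right, h1, h2, h3, h4, hmM, sub_self,
    abs_zero, sub_zero, zero_sub, abs_neg, abs_abs, zero_add, add_zero] <;>
  grind

/-- The function which agrees with `f` on `[m, M]` and has slope `±L` away from it. -/
theorem exists_lipschitz_modification {L σ : ℝ} (hL : 0 ≤ L) (hσ : |σ| = 1) {f : ℝ → ℝ}
    (hf : ∀ x y, |f x - f y| ≤ L * |x - y|) {m M : ℝ} (hmM : m ≤ M) :
    ∃ g : ℝ → ℝ, (∀ x y, |g x - g y| ≤ L * |x - y|) ∧ (∀ x, m ≤ x → x ≤ M → g x = f x) ∧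
      (∀ d, 0 ≤ d → g (M + d) = f M + σ * (L * d)) ∧
      (∀ d, 0 ≤ d → g (m - d) = f m + σ * (L * d)) := by
  refine ⟨fun x => f (max m (min x M)) + σ * (L * |x - max m (min x M)|), fun x y => ?_,
    fun x h1 h2 => ?_, fun d hd => ?_, fun d hd => ?_⟩
  · have e1 := hf (max m (min x M)) (max m (min y M))
    have e2 := mul_le_mul_of_nonneg_left (abs_clamp_sub_add_le m M x y hmM) hL
    have e3 : |σ * (L * |x - max m (min x M)|) - σ * (L * |y - max m (min y M)|)| =
        L * |(|x - max m (min x M)|) - (|y - max m (min y M)|)| := by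
      rw [← mul_sub, ← mul_sub, abs_mul, abs_mul, hσ, abs_of_nonneg hL, one_mul]
    calc _ = |(f (max m (min x M)) - f (max m (min y M))) +
          (σ * (L * |x - max m (min x M)|) - σ * (L * |y - max m (min y M)|))| := by ring_nf
      _ ≤ _ := (abs_add_le _ _).trans (by linarith)
  · simp [h1, h2]
  · have : min (M + d) M = M := min_eq_right (by linarith)
    simp [this, hmM, abs_of_nonneg hd]
  · have : min (m - d) M = m - d := min_eq_left (by linarith)
    have h' : max m (m - d) = m := max_eq_left (by linarith)
    simp [this, h', abs_of_nonneg hd]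

/-- The states at time `t + 1` leave an interval `[m, M]` of all earlier states by some `d ≥ κ ^ t`,
and all states up to time `t + 1` lie in an interval of length at most `2 p d`. -/
def Spread {n : ℕ} (p κ : ℝ) (x : ℕ → Fin n → ℝ) (t : ℕ) : Prop :=
  ∃ m M m' M' d, (∀ s ≤ t, ∀ i, m ≤ x s i ∧ x s i ≤ M) ∧
    (∀ s ≤ t + 1, ∀ i, m' ≤ x s i ∧ x s i ≤ M') ∧
    (∃ k, x (t + 1) k = M + d ∨ x (t + 1) k = m - d) ∧ M' - m' ≤ 2 * p * d ∧ κ ^ t ≤ d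

/-- The node farthest from the centre defines `d`. A single node extends the range on one side only,
so the half-length grows by `d / 2`; several nodes may extend both sides, whence `θ = 1`. -/
theorem exists_expansion {n : ℕ} {θ : ℝ} (hθ : θ = 1 ∨ θ = 1 / 2 ∧ n = 1) {x : ℕ → Fin n → ℝ}
    {t : ℕ} {m M D : ℝ} (hD : 0 < D) (hx : ∀ s ≤ t, ∀ i, m ≤ x s i ∧ x s i ≤ M) {k : Fin n}
    (hk : (M - m) / 2 + D ≤ |x (t + 1) k - (m + M) / 2|) :
    ∃ m' M' d, D ≤ d ∧ (∀ s ≤ t + 1, ∀ i, m' ≤ x s i ∧ x s i ≤ M') ∧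
      (∃ k, x (t + 1) k = M + d ∨ x (t + 1) k = m - d) ∧ M' - m' ≤ M - m + 2 * θ * d := by
  have : Nonempty (Fin n) := ⟨k⟩
  obtain ⟨k', hk'⟩ := Finite.exists_max fun i => |x (t + 1) i - (m + M) / 2|
  obtain ⟨d, hd⟩ : ∃ d, d = |x (t + 1) k' - (m + M) / 2| - (M - m) / 2 := ⟨_, rfl⟩
  have hDd : D ≤ d := by linarith [hk' k]
  have hor : x (t + 1) k' = M + d ∨ x (t + 1) k' = m - d := by
    rcases abs_choice (x (t + 1) k' - (m + M) / 2) with h | h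
    · left; linarith
    · right; linarith
  have hall : ∀ i, m - d ≤ x (t + 1) i ∧ x (t + 1) i ≤ M + d := fun i => by
    have := abs_le.1 (hk' i)
    constructor <;> linarith
  rcases hθ with rfl | ⟨rfl, rfl⟩
  · refine ⟨m - d, M + d, d, hDd, fun s hs i => ?_, ⟨k', hor⟩, by linarith⟩
    rcases Nat.le_succ_iff.1 hs with hs | rfl
    · have := hx s hs i
      constructor <;> linarith
    · exact hall i
  · have hmM := hx 0 (Nat.zero_le _) k
    rcases hor with h | h
    · refine ⟨m, M + d, d, hDd, fun s hs i => ?_, ⟨k', Or.inl h⟩, by linarith⟩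
      rcases Nat.le_succ_iff.1 hs with hs | rfl
      · have := hx s hs i
        constructor <;> linarith
      · rw [Subsingleton.elim i k', h]
        constructor <;> linarith
    · refine ⟨m - d, M, d, hDd, fun s hs i => ?_, ⟨k', Or.inr h⟩, by linarith⟩
      rcases Nat.le_succ_iff.1 hs with hs | rfl
      · have := hx s hs i
        constructor <;> linarith
      · rw [Subsingleton.elim i k', h]
        constructor <;> linarith

section Adversary

variable {n : ℕ} {h : GlobalLaw n} {W : Matrix (Fin n) (Fin n) ℝ} {a L θ p : ℝ} {X₀ : Fin n → ℝ}
  {w e : ℕ → Fin n → ℝ}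

theorem exists_sign (b c D : ℝ) : ∃ σ : ℝ, |σ| = 1 ∧ D ≤ |b + σ * D - c| := by
  rcases le_total c b with hbc | hbc
  · exact ⟨1, by simp, le_trans (by linarith) (le_abs_self _)⟩
  · exact ⟨-1, by simp, le_trans (by linarith) (neg_le_abs _)⟩

variable (h W X₀ w e) in
theorem exists_initial_spread (hn : 0 < n) (ha : 0 < a) (hL : 0 ≤ L)
    (hθ : θ = 1 ∨ θ = 1 / 2 ∧ n = 1) (hθp : θ < p) :
    ∃ f x u, (∀ y y', |f y - f y'| ≤ L * |y - y'|) ∧ IsRun h W a X₀ w e f x u ∧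
      Spread p (a * L - p) x 0 := by
  obtain ⟨M, hM⟩ := (Set.finite_range X₀).bddAbove
  obtain ⟨m, hm⟩ := (Set.finite_range X₀).bddBelow
  have hX : ∀ i, m ≤ X₀ i ∧ X₀ i ≤ M := fun i => ⟨hm ⟨i, rfl⟩, hM ⟨i, rfl⟩⟩
  obtain ⟨x₀, u₀, hr₀⟩ := exists_isRun h W a X₀ w e fun _ => 0
  let k : Fin n := ⟨0, hn⟩
  -- Makes `M - m + 2 θ d ≤ 2 p d`. The input at time `0` does not depend on `f`, so a constant
  -- function can place node `k` at `M + D`.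
  set D := max 1 ((M - m) / (2 * (p - θ))) with hD
  have hD1 : 1 ≤ D := le_max_left _ _
  obtain ⟨x, u, hr⟩ := exists_isRun h W a X₀ w e fun _ => (M + D - u₀ 0 k - w 0 k) / a
  have hu : u₀ 0 = u 0 := (hr₀.congr hr 0 (by simp) 0 le_rfl).2
  have hx1 : x 1 k = M + D := by
    rw [hr.dynamics, ← hu, mul_div_cancel₀ _ ha.ne']
    ring
  have hx0 : ∀ s ≤ 0, ∀ i, m ≤ x s i ∧ x s i ≤ M := fun s hs i => by
    obtain rfl : s = 0 := by omega
    rw [hr.init]; exact hX i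
  obtain ⟨m', M', d, hDd, h1, h2, h3⟩ := exists_expansion hθ (x := x) (t := 0) (k := k)
    (by linarith : 0 < D) hx0 (by
      rw [zero_add, hx1]
      exact le_trans (by linarith) (le_abs_self _))
  refine ⟨_, x, u, fun y y' => ?_, hr, m, M, m', M', d, hx0, h1, h2, h3.trans ?_, ?_⟩
  · rw [sub_self, abs_zero]; positivity
  · have : (M - m) / (2 * (p - θ)) ≤ d := (le_max_right _ _).trans hDd
    rw [div_le_iff₀ (by linarith)] at this
    linarith
  · rw [pow_zero]; linarith

/-- The chosen sign puts a state at distance at least `a L d` from the centre of a range of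
half-length at most `p d`, so the new expansion is `d' ≥ (a L - p) d`. The new half-length is at
most `(p / (a L - p) + θ) d'`, and `hp` says that this is at most `p d'`. -/
theorem exists_spread_succ (hL : 0 ≤ L) (hθ : θ = 1 ∨ θ = 1 / 2 ∧ n = 1)
    (hp0 : 0 ≤ p) (hpl : p < a * L) (hp : p + θ * (a * L - p) ≤ p * (a * L - p)) {f : ℝ → ℝ}
    {x u : ℕ → Fin n → ℝ} (hf : ∀ y y', |f y - f y'| ≤ L * |y - y'|)
    (hr : IsRun h W a X₀ w e f x u) {t : ℕ} (hs : Spread p (a * L - p) x t) :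
    ∃ f' x' u', (∀ y y', |f' y - f' y'| ≤ L * |y - y'|) ∧ IsRun h W a X₀ w e f' x' u' ∧
      Spread p (a * L - p) x' (t + 1) ∧ ∀ s ≤ t, ∀ i, f' (x s i) = f (x s i) := by
  obtain ⟨m, M, m', M', d, h1, h2, ⟨k, hk⟩, h3, h4⟩ := hs
  have hκ : 0 < a * L - p := by linarith
  have hd : 0 < d := (pow_pos hκ t).trans_le h4
  have hmM : m ≤ M := (h1 0 (by omega) k).1.trans (h1 0 (by omega) k).2
  obtain ⟨E, hE⟩ : ∃ E, ∀ σ : ℝ, |σ| = 1 → ∃ f' : ℝ → ℝ, (∀ y y', |f' y - f' y'| ≤ L * |y - y'|) ∧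
      (∀ y, m ≤ y → y ≤ M → f' y = f y) ∧ f' (x (t + 1) k) = E + σ * (L * d) := by
    rcases hk with hk | hk
    · refine ⟨f M, fun σ hσ => ?_⟩
      obtain ⟨g, g1, g2, g3, -⟩ := exists_lipschitz_modification hL hσ hf hmM
      exact ⟨g, g1, g2, by rw [hk, g3 d hd.le]⟩
    · refine ⟨f m, fun σ hσ => ?_⟩
      obtain ⟨g, g1, g2, -, g3⟩ := exists_lipschitz_modification hL hσ hf hmM
      exact ⟨g, g1, g2, by rw [hk, g3 d hd.le]⟩
  -- The sign may depend on `u (t + 1)`: by causality this input is unaffected by the modification.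
  obtain ⟨σ, hσ, hσd⟩ := exists_sign (a * E + u (t + 1) k + w (t + 1) k) ((m' + M') / 2)
    (a * L * d)
  obtain ⟨f', f1, f2, f3⟩ := hE σ hσ
  obtain ⟨x', u', hr'⟩ := exists_isRun h W a X₀ w e f'
  have hff : ∀ s ≤ t, ∀ i, f' (x s i) = f (x s i) := fun s hs i =>
    f2 _ (h1 s hs i).1 (h1 s hs i).2
  have hxx := hr.congr hr' (t + 1) fun s hs i => hff s (by omega) i
  have hx2 : x' (t + 2) k = a * E + u (t + 1) k + w (t + 1) k + σ * (a * L * d) := by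
    rw [hr'.dynamics, ← (hxx (t + 1) le_rfl).1, ← (hxx (t + 1) le_rfl).2, f3]
    ring
  have h2' : ∀ s ≤ t + 1, ∀ i, m' ≤ x' s i ∧ x' s i ≤ M' := fun s hs i => by
    rw [← (hxx s hs).1]; exact h2 s hs i
  obtain ⟨m'', M'', d', e1, e2, e3, e4⟩ := exists_expansion hθ (x := x') (t := t + 1) (k := k)
    (mul_pos hκ hd) h2' (by
      rw [show t + 1 + 1 = t + 2 from rfl, hx2]
      refine le_trans ?_ hσd
      linarith)
  refine ⟨f', x', u', f1, hr', ⟨m', M', m'', M'', d', h2', e2, e3, e4.trans ?_, ?_⟩, hff⟩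
  · have e5 : p * ((a * L - p) * d) ≤ p * d' := mul_le_mul_of_nonneg_left e1 hp0
    have e6 : p * d' + θ * (a * L - p) * d' ≤ p * (a * L - p) * d' := by
      have := mul_le_mul_of_nonneg_right hp ((mul_pos hκ hd).le.trans e1)
      linarith
    have e7 : (a * L - p) * (M' - m' + 2 * θ * d') ≤ (a * L - p) * (2 * p * d') := by
      have := mul_le_mul_of_nonneg_left h3 hκ.le
      linarith
    exact le_of_mul_le_mul_left e7 hκ
  · rw [pow_succ, mul_comm]
    exact (mul_le_mul_of_nonneg_left h4 hκ.le).trans e1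

variable (h W X₀ w e) in
theorem exists_diverging_run (hn : 0 < n) (ha : 0 < a) (hL : 0 ≤ L)
    (hθ : θ = 1 ∨ θ = 1 / 2 ∧ n = 1) (hp0 : 0 ≤ p) (hθp : θ < p) (hpl : p + 1 < a * L)
    (hp : p + θ * (a * L - p) ≤ p * (a * L - p)) :
    ∃ f x u, (∀ y y', |f y - f y'| ≤ L * |y - y'|) ∧ IsRun h W a X₀ w e f x u ∧
      ∀ t, Spread p (a * L - p) x t := by
  let State : ℕ → Type := fun t =>
    {q : (ℝ → ℝ) × (ℕ → Fin n → ℝ) × (ℕ → Fin n → ℝ) //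
      (∀ y y', |q.1 y - q.1 y'| ≤ L * |y - y'|) ∧ IsRun h W a X₀ w e q.1 q.2.1 q.2.2 ∧
        Spread p (a * L - p) q.2.1 t}
  have hsucc : ∀ t (q : State t), ∃ q' : State (t + 1),
      ∀ s ≤ t, ∀ i, q'.1.1 (q.1.2.1 s i) = q.1.1 (q.1.2.1 s i) := by
    rintro t ⟨⟨f, x, u⟩, hf, hr, hs⟩
    obtain ⟨f', x', u', h1, h2, h3, h4⟩ :=
      exists_spread_succ hL hθ hp0 (by linarith) hp hf hr hs
    exact ⟨⟨(f', x', u'), h1, h2, h3⟩, h4⟩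
  choose next hnext using hsucc
  obtain ⟨f₀, x₀, u₀, hf₀, hr₀, hs₀⟩ := exists_initial_spread h W X₀ w e hn ha hL hθ hθp
  let q : ∀ t, State t := fun t => Nat.rec ⟨(f₀, x₀, u₀), hf₀, hr₀, hs₀⟩ next t
  have hq : ∀ t, ∀ s ≤ t, ∀ i,
      (q (t + 1)).1.1 ((q t).1.2.1 s i) = (q t).1.1 ((q t).1.2.1 s i) := fun t => hnext t (q t)
  let f : ℕ → ℝ → ℝ := fun t => (q t).1.1
  let x : ℕ → ℕ → Fin n → ℝ := fun t => (q t).1.2.1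
  have hr : ∀ t, IsRun h W a X₀ w e (f t) (x t) (q t).1.2.2 := fun t => (q t).2.2.1
  have hxs : ∀ t d, ∀ s ≤ t, x (t + d) s = x t s := by
    intro t d s hs
    induction d with
    | zero => rfl
    | succ d ih =>
      rw [← ih, ← add_assoc]
      exact ((hr (t + d)).congr (hr (t + d + 1)) (t + d)
        (fun r hr' i => hq (t + d) r hr'.le i) s (by omega)).1.symm
  have hfs : ∀ t d, ∀ s ≤ t, ∀ i, f (t + d) (x t s i) = f t (x t s i) := by
    intro t d s hs i
    induction d with
    | zero => rfl
    | succ d ih =>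
      rw [← ih, ← hxs t d s hs]
      exact hq (t + d) s (by omega) i
  let S : Set ℝ := {y | ∃ t, ∃ s ≤ t, ∃ i, y = x t s i}
  -- On visited states the sequence is eventually constant; elsewhere the value is irrelevant, since
  -- only the restriction to `S` is extended.
  let F : ℝ → ℝ := fun y => limUnder atTop fun t => f t y
  have htends : ∀ t, ∀ s ≤ t, ∀ i,
      Tendsto (fun t' => f t' (x t s i)) atTop (𝓝 (f t (x t s i))) := fun t s hs i =>
    tendsto_const_nhds.congr' (by
      filter_upwards [eventually_ge_atTop t] with t' ht'
      have := hfs t (t' - t) s hs i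
      rwa [Nat.add_sub_cancel' ht', eq_comm] at this)
  have hF : ∀ t, ∀ s ≤ t, ∀ i, F (x t s i) = f t (x t s i) := fun t s hs i =>
    (htends t s hs i).limUnder_eq
  have hLip : LipschitzOnWith L.toNNReal F S := by
    refine LipschitzOnWith.of_dist_le_mul ?_
    rintro _ ⟨t, s, hs, i, rfl⟩ _ ⟨t', s', hs', i', rfl⟩
    rw [hF t s hs, hF t' s' hs', Real.coe_toNNReal _ hL]
    exact le_of_tendsto ((htends t s hs i).dist (htends t' s' hs' i'))
      (Eventually.of_forall fun r => (q r).2.1 _ _)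
  obtain ⟨G, hG, hGF⟩ := hLip.extend_real
  obtain ⟨X, U, hX⟩ := exists_isRun h W a X₀ w e G
  refine ⟨G, X, U, fun y y' => ?_, hX, fun t => ?_⟩
  · have := hG.dist_le_mul y y'
    rwa [Real.coe_toNNReal _ hL] at this
  · have hXt := (hr t).congr hX (t + 1) fun s hs i => by
      rw [← hF t s (by omega) i]
      exact (hGF ⟨t, s, by omega, i, rfl⟩).symm
    obtain ⟨m, M, m', M', d, h1, h2, h3, h4⟩ := (q t).2.2.2
    refine ⟨m, M, m', M', d, fun s hs i => ?_, fun s hs i => ?_, ?_, h4⟩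
    · rw [← (hXt s (by omega)).1]; exact h1 s hs i
    · rw [← (hXt s hs).1]; exact h2 s hs i
    · rw [← (hXt (t + 1) le_rfl).1]; exact h3

end Adversary

theorem limsup_eq_top_of_spread {n : ℕ} {p κ : ℝ} (hκ : 1 < κ) {x : ℕ → Fin n → ℝ}
    (hx : ∀ t, Spread p κ x t) : limsup (fun t => ((⨆ i, |x t i| : ℝ) : EReal)) atTop = ⊤ := by
  refine Tendsto.limsup_eq ?_
  rw [EReal.tendsto_coe_nhds_top_iff, ← tendsto_add_atTop_iff_nat 1]
  obtain ⟨B, hB⟩ := (Set.finite_range fun i => |x 0 i|).bddAbove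
  refine tendsto_atTop_mono (fun t => ?_)
    (tendsto_atTop_add_const_right _ (-B) (tendsto_pow_atTop_atTop_of_one_lt hκ))
  obtain ⟨m, M, m', M', d, h1, -, ⟨k, hk⟩, -, h4⟩ := hx t
  refine le_trans ?_ (le_ciSup (f := fun i => |x (t + 1) i|) (Set.finite_range _).bddAbove k)
  have e1 := h1 0 (Nat.zero_le _) k
  have e2 : |x 0 k| ≤ B := hB ⟨k, rfl⟩
  have e3 := abs_le.1 e2
  rcases hk with hk | hk
  · exact le_trans (by linarith) (le_abs_self _)
  · exact le_trans (by linarith) (neg_le_abs _)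

/-! ### Self-loop graphs and the final assembly. -/

namespace InteractionGraph

/-- The graph with a self-arc of weight `a` at each node and no other arcs. -/
def selfLoops (n : ℕ) {a : ℝ} (ha : a ≠ 0) : InteractionGraph n where
  graph := ⟨fun j i => j = i⟩
  weight := Matrix.diagonal fun _ => a
  weight_ne_zero_iff i j := by
    by_cases hij : i = j
    · simp [hij, ha]
    · simp [hij, Ne.symm hij]

theorem selfLoops_neighbors (n : ℕ) {a : ℝ} (ha : a ≠ 0) (i : Fin n) :
    (selfLoops n ha).neighbors i = {i} := by
  ext j
  classical
  rw [neighbors, Finset.mem_filter, Finset.mem_singleton]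
  exact and_iff_right (Finset.mem_univ j)

theorem selfLoops_weight_self (n : ℕ) {a : ℝ} (ha : a ≠ 0) (i : Fin n) :
    (selfLoops n ha).weight i i = a := by
  simp [selfLoops]

theorem selfLoops_infNorm {n : ℕ} (hn : 0 < n) {a : ℝ} (ha : 0 < a) :
    (selfLoops n ha.ne').infNorm = a := by
  have : Nonempty (Fin n) := ⟨⟨0, hn⟩⟩
  simp [infNorm, selfLoops_neighbors, selfLoops_weight_self, abs_of_pos ha]

theorem selfLoops_isSingleSelfLoop {a : ℝ} (ha : a ≠ 0) :
    (selfLoops 1 ha).IsSingleSelfLoop :=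
  ⟨0, fun j i => by simp [selfLoops, Subsingleton.elim j 0, Subsingleton.elim i 0]⟩

end InteractionGraph

theorem defeated_selfLoops {n : ℕ} (hn : 0 < n) {a L θ p : ℝ} (ha : 0 < a) (hL : 0 ≤ L)
    (hθ : θ = 1 ∨ θ = 1 / 2 ∧ n = 1) (hp0 : 0 ≤ p) (hθp : θ < p) (hpl : p + 1 < a * L)
    (hp : p + θ * (a * L - p) ≤ p * (a * L - p)) (h : GlobalLaw n) (X₀ : Fin n → ℝ) :
    Defeated L h (InteractionGraph.selfLoops n ha.ne') X₀ := by
  intro wstar D₀ w e _ hw he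
  obtain ⟨f, x, u, hf, hr, hs⟩ := exists_diverging_run h
    (InteractionGraph.selfLoops n ha.ne').weight X₀ w e hn ha hL hθ hp0 hθp hpl hp
  refine ⟨f, mem_functionClass_of_lipschitz hf, fun t i => f (x t i) + e t i, x, u,
    ⟨hw, fun t i => ?_, fun t i => ?_, hr.control⟩, hr.init, fun _ _ => rfl,
    limsup_eq_top_of_spread (by linarith) hs⟩
  · rw [sub_add_cancel_left, abs_neg]; exact he t i
  · rw [hr.dynamics, InteractionGraph.selfLoops_neighbors, Finset.sum_singleton,
      InteractionGraph.selfLoops_weight_self]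

theorem defeated_selfLoop {a L : ℝ} (ha : 0 < a) (hL : (3 / 2 + √2) / a ≤ L) (h : GlobalLaw 1)
    (X₀ : Fin 1 → ℝ) : Defeated L h (InteractionGraph.selfLoops 1 ha.ne') X₀ := by
  have h2 : √2 ^ 2 = (2 : ℝ) := Real.sq_sqrt (by norm_num)
  have h1 : 1 < √2 := Real.lt_sqrt_of_sq_lt (by norm_num)
  have hl : 3 / 2 + √2 ≤ a * L := by rwa [div_le_iff₀ ha, mul_comm] at hL
  have hL0 : 0 ≤ L := le_trans (by positivity) hL
  obtain ⟨s, hs⟩ : ∃ s, s = √(a * L) := ⟨_, rfl⟩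
  have hs2 : a * L = s ^ 2 := by rw [hs, Real.sq_sqrt (by linarith)]
  have hs1 : 1 + √2 / 2 ≤ s := by
    rw [hs]
    refine Real.le_sqrt_of_sq_le ?_
    nlinarith
  -- This `p` gives growth factor `s = √(a L)`, the equality case of the gain estimate; the
  -- condition becomes `(s - 1)² ≥ 1/2`.
  refine defeated_selfLoops one_pos (θ := 1 / 2) (p := s ^ 2 - s) ha hL0 (Or.inr ⟨rfl, rfl⟩)
    (by nlinarith) (by nlinarith) (by linarith) ?_ h X₀
  rw [hs2]
  have h3 : 1 / 2 ≤ (s - 1) ^ 2 := by nlinarith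
  nlinarith

theorem not_stabilizes_of_defeated {n : ℕ} {L : ℝ} {h : GlobalLaw n} {G : InteractionGraph n}
    {X₀ : Fin n → ℝ} (hd : Defeated L h G X₀) (hs : ∀ f ∈ functionClass L, Stabilizes h G f) :
    False := by
  obtain ⟨f, hf, z, x, u, hcl, -, -, hlim⟩ := hd 1 0 0 0 one_pos (by simp) (by simp)
  have hb := hs f hf 1 0 0 z x u one_pos hcl
  choose B hB using hb
  obtain ⟨C, hC⟩ := (Set.finite_range B).bddAbove
  have hle : ∀ t, ((⨆ i, |x t i| : ℝ) : EReal) ≤ ((max C 0 : ℝ) : EReal) := fun t => by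
    rw [EReal.coe_le_coe_iff]
    refine Real.iSup_le (fun i => ?_) (le_max_right _ _)
    have h1 : |x t i| + |u t i| ≤ B i := hB i ⟨t, rfl⟩
    have h2 : B i ≤ C := hC ⟨i, rfl⟩
    exact le_max_of_le_left (by linarith [abs_nonneg (u t i)])
  have := Filter.limsup_le_of_le (f := atTop) (h := Eventually.of_forall hle)
  rw [hlim, top_le_iff] at this
  exact EReal.coe_ne_top _ this

theorem theorem1 (L : ℝ) (hL : 0 < L) :
    -- a generic law for all graphs with `‖A_G‖_∞ = a` exists iff `L < (3/2 + √2) / a`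
    (∀ a : ℝ, 0 < a →
      ((∃ h : ∀ n, GlobalLaw n, ∀ (n : ℕ) (G : InteractionGraph n), G.infNorm = a →
          ∀ f ∈ functionClass L, Stabilizes (h n) G f) ↔
        L < (3 / 2 + √2) / a)) ∧
    -- (i) the nearest-neighbour laws; the hypothesis is `L < (3/2 + √2) / ‖A_G‖_∞`,
    -- where the right-hand side is `+∞` if `A_G = 0`
    (∀ (n : ℕ) (ε : ℝ), 0 < ε →
      (∃ h : GlobalLaw n, IsNearestNeighborLaw ε h) ∧
      ∀ h : GlobalLaw n, IsNearestNeighborLaw ε h →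
        ∀ G : InteractionGraph n, L * G.infNorm < 3 / 2 + √2 →
        ∀ f ∈ functionClass L,
          Stabilizes h G f ∧
          ∀ (wstar D₀ : ℝ) (w z x u : ℕ → Fin n → ℝ), 0 < wstar →
            IsClosedLoop h G f wstar D₀ w z x u →
            ∀ i, limsup (fun t => ((|x t i| : ℝ) : EReal)) atTop ≤
              (((offsetBound L f ((3 / 2 + √2) / G.infNorm) + D₀) * G.infNorm + wstar : ℝ) :
                EReal)) ∧
    -- (ii) at or above the threshold, for each prescribed value `a` of the norm
    (∀ a : ℝ, 0 < a → (3 / 2 + √2) / a ≤ L →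
      ∀ h : ∀ n, GlobalLaw n, ∃ (n : ℕ) (G : InteractionGraph n),
        G.infNorm = a ∧ G.IsSingleSelfLoop ∧ ∀ X₀ : Fin n → ℝ, Defeated L (h n) G X₀) ∧
    -- (ii) for each prescribed number of nodes
    (∀ n : ℕ, 0 < n → ∀ (h : GlobalLaw n) (X₀ : Fin n → ℝ), ∃ G : InteractionGraph n,
      0 < G.infNorm ∧ (3 / 2 + √2) / G.infNorm ≤ L ∧ Defeated L h G X₀) := by
  have hi : ∀ (n : ℕ) (ε : ℝ), 0 < ε → ∀ h : GlobalLaw n, IsNearestNeighborLaw ε h →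
      ∀ G : InteractionGraph n, L * G.infNorm < 3 / 2 + √2 → ∀ f ∈ functionClass L,
        Stabilizes h G f :=
    fun n ε hε h hh G hG f hf => hh.stabilizes hε hL hG hf
  refine ⟨fun a ha => ⟨?_, fun hLa => ?_⟩, fun n ε hε => ⟨exists_isNearestNeighborLaw n ε,
    fun h hh G hG f hf => ⟨hi n ε hε h hh G hG f hf, fun wstar D₀ w z x u hw hcl i =>
      hh.limsup_le hε hL hG hf hw hcl i⟩⟩, fun a ha haL h => ?_, fun n hn h X₀ => ?_⟩
  · rintro ⟨h, hh⟩
    by_contra hcon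
    exact not_stabilizes_of_defeated (defeated_selfLoop ha (not_lt.1 hcon) (h 1) 0)
      (hh 1 _ (InteractionGraph.selfLoops_infNorm one_pos ha))
  · choose h hh using fun n => exists_isNearestNeighborLaw n 1
    refine ⟨h, fun n G hG => hi n 1 one_pos (h n) (hh n) G ?_⟩
    rw [hG]
    exact (lt_div_iff₀ ha).1 hLa
  · exact ⟨1, InteractionGraph.selfLoops 1 ha.ne', InteractionGraph.selfLoops_infNorm one_pos ha,
      InteractionGraph.selfLoops_isSingleSelfLoop ha.ne', fun X₀ =>
        defeated_selfLoop ha haL (h 1) X₀⟩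
  -- With `a L = 4`, `θ = 1` and `p = 2` the condition is the equality `2 + 2 = 2 * 2`, with growth
  -- factor `2`.
  · have ha : 0 < 4 / L := by positivity
    have hl : 4 / L * L = 4 := div_mul_cancel₀ _ hL.ne'
    have h2 : √2 ≤ 2 := Real.sqrt_le_iff.2 ⟨by norm_num, by norm_num⟩
    refine ⟨InteractionGraph.selfLoops n ha.ne', ?_, ?_,
      defeated_selfLoops hn (θ := 1) (p := 2) ha hL.le (Or.inl rfl) (by norm_num) (by norm_num)
        (by rw [hl]; norm_num) (by rw [hl]; norm_num) h X₀⟩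
    · rw [InteractionGraph.selfLoops_infNorm hn ha]; exact ha
    · rw [InteractionGraph.selfLoops_infNorm hn ha, div_le_iff₀ ha, mul_comm, hl]
      linarith
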